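/- Let $\mathbb T=\mathbb R_+=[0,\infty)$ or $\mathbb T=\mathbb R$, let $C(\mathbb T\times\mathbb R,\mathbb R)$ carry the compact-open topology, and let $\tau>0$. For $f\in C(\mathbb T\times\mathbb R,\mathbb R)$ put $f^h(t,x):=f(t+h,x)$ ($h\in\mathbb T$) and $H(f):=\overline{\{f^h : h\in\mathbb T\}}$. Call $f$ regular if for every $u\in\mathbb R$ and every $g\in H(f)$ the equation $x'=g(t,x)$ has a unique solution defined on $\mathbb R_+$ with $x(0)=u$. Let $f\in C(\mathbb T\times\mathbb R,\mathbb R)$ be regular, and assume: 1. $f$ is asymptotically $\tau$-periodic in time, i.e. $f=P+R$ with $P,R\in C(\mathbb T\times\mathbb R,\mathbb R)$, where $P(t+\tau,x)=P(t,x)$ for all $(t,x)\in\mathbb T\times\mathbb R$, and $\lim_{t\to+\infty}|R(t,x)|=0$ uniformly with respect to $x$ in every compact subset of $\mathbb R$; 2. every $\tau$-periodic solution of the equation $x'=P(t,x)$ is isolated; here a $\tau$-periodic solution $\psi$ is called isolated if there is $\delta>0$ such that no point $u\neq\psi(0)$ of the interval $(\psi(0)-\delta,\psi(0)+\delta)$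 is the value at $t=0$ of a $\tau$-periodic solution of $x'=P(t,x)$. Then every solution $\varphi$ of $x'=f(t,x)$ that is defined and bounded on $\mathbb R_+$ is asymptotically $\tau$-periodic, i.e. there is a continuous $\tau$-periodic function $p:\mathbb R\to\mathbb R$ such that $\lim_{t\to+\infty}|\varphi(t)-p(t)|=0$. -/

import Mathlib

open Set Filter Topology

namespace AsympPeriodic

/-- The `h`-translation in time, `f^h (t, x) = f (t + h, x)`, of a continuous function
`f : 𝕋 × ℝ → ℝ`, for `h ∈ 𝕋`. -/
def timeTranslate {T : AddSubmonoid ℝ} (f : C(T × ℝ, ℝ)) (h : T) : C(T × ℝ, ℝ) where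
  toFun z := f (z.1 + h, z.2)
  continuous_toFun := by fun_prop

/-- The hull `H(f)`: the closure of the set of all translations `f^h`, `h ∈ 𝕋`, in the space
`C(𝕋 × ℝ, ℝ)` with the compact-open topology. -/
def hull {T : AddSubmonoid ℝ} (f : C(T × ℝ, ℝ)) : Set C(T × ℝ, ℝ) :=
  closure (range (timeTranslate f))

/-- `x` is a solution on `ℝ₊ = [0, ∞)` of the equation `x' = g(t, x)` (with the one-sided
derivative at `t = 0`). Only the values of `x` on `[0, ∞)` matter. -/
def IsSolution {T : AddSubmonoid ℝ} (g : C(T × ℝ, ℝ)) (x : ℝ → ℝ) : Prop :=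
  ∀ t : T, 0 ≤ (t : ℝ) → HasDerivWithinAt x (g (t, x t)) (Ici 0) t

/-- `f` is regular: for all `u ∈ ℝ` and `g ∈ H(f)` the equation `x' = g(t, x)` has a unique
solution on `ℝ₊` with `x(0) = u`. -/
def IsRegularRHS {T : AddSubmonoid ℝ} (f : C(T × ℝ, ℝ)) : Prop :=
  ∀ u : ℝ, ∀ g ∈ hull f, ∃ x : ℝ → ℝ, (IsSolution g x ∧ x 0 = u) ∧
    ∀ y : ℝ → ℝ, IsSolution g y → y 0 = u → EqOn y x (Ici 0)

/-- `f = P + R` with `P` `τ`-periodic in time and `R(t, x) → 0` as `t → +∞`, uniformly in `x` on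
every compact subset of `ℝ`. -/
structure IsAsymptoticallyPeriodicDecomposition {T : AddSubmonoid ℝ} (τ : T)
    (f P R : C(T × ℝ, ℝ)) : Prop where
  eq_add : ∀ (t : T) (x : ℝ), f (t, x) = P (t, x) + R (t, x)
  periodic : ∀ (t : T) (x : ℝ), P (t + τ, x) = P (t, x)
  tendsto_zero : ∀ K : Set ℝ, IsCompact K →
    TendstoUniformlyOn (fun (t : T) (x : ℝ) => R (t, x)) (fun _ => 0) atTop K

/-- `x` is a `τ`-periodic solution on `ℝ₊` of `x' = P(t, x)`. -/
def IsPeriodicSolution {T : AddSubmonoid ℝ} (τ : T) (P : C(T × ℝ, ℝ)) (x : ℝ → ℝ) : Prop :=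
  IsSolution P x ∧ ∀ t : ℝ, 0 ≤ t → x (t + τ) = x t

/-- The `τ`-periodic solution `x` of `x' = P(t, x)` is isolated: for some `δ > 0`, no point of
`(x 0 - δ, x 0 + δ)` other than `x 0` is the initial value of a `τ`-periodic solution. -/
def IsIsolatedPeriodicSolution {T : AddSubmonoid ℝ} (τ : T) (P : C(T × ℝ, ℝ))
    (x : ℝ → ℝ) : Prop :=
  IsPeriodicSolution τ P x ∧ ∃ δ > 0, ∀ u ∈ Ioo (x 0 - δ) (x 0 + δ), u ≠ x 0 →
    ¬ ∃ y : ℝ → ℝ, IsPeriodicSolution τ P y ∧ y 0 = u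

/-- The function `x` on `ℝ₊` is asymptotically `τ`-periodic: there is a continuous `τ`-periodic
`p : ℝ → ℝ` with `|x(t) - p(t)| → 0` as `t → +∞`. -/
def IsAsymptoticallyPeriodic (τ : ℝ) (x : ℝ → ℝ) : Prop :=
  ∃ p : ℝ → ℝ, Continuous p ∧ Function.Periodic p τ ∧
    Tendsto (fun t => |x t - p t|) atTop (𝓝 0)

end AsympPeriodic

/-!
Along a bounded solution `φ` of `x' = f(t, x)` the part `R` of the right-hand side is a forcing term
`r(t) = R(t, φ(t))` that tends to `0`, so `φ' = P(t, φ) + r(t)`. Since `P` is periodic in time and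
`φ` is bounded, `φ` is eventually Lipschitz. Hence, along any ultrafilter on `ℕ` finer than `atTop`,
the translates `φ(· + nτ)` converge pointwise, and their limit solves `x' = P(t, x)`
(`SolvesOnNonneg.of_tendsto_translates`).

Every translate `P^s` lies in the hull of `f`, as the limit of `f^(s + nτ)`
(`IsAsymptoticallyPeriodicDecomposition.timeTranslate_mem_hull`). Regularity of `f` therefore gives
a period map `Φ` of `x' = P(t, x)`, which is monotone because solutions cannot change their order
(`SolvesOnNonneg.le_of_le`) and whose fixed points are the initial values of the `τ`-periodic
solutions. Whenever the sequence `x n = φ(nτ)` tends to `d` along an ultrafilter, `x (n + 1)` tends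
to `Φ d`. In dimension one such a sequence cannot oscillate: every level between its lower and upper
limits would be a fixed point of `Φ`, against isolation (`exists_fixed_point_tendsto`). So
`φ(nτ)` tends to a fixed point of `Φ`, and `φ(t + nτ)` tends to the periodic solution `ψ` starting
there. The Lipschitz bound makes this convergence uniform over a period, and `φ` is asymptotic to
the periodic extension of `ψ` (`isAsymptoticallyPeriodic_of_tendsto_translates`).
-/

namespace AsympPeriodic

/-! ### Sequences with monotone limit dynamics -/

theorem frequently_and_not_succ {p : ℕ → Prop} (h1 : ∃ᶠ n in atTop, p n)
    (h2 : ∃ᶠ n in atTop, ¬ p n) : ∃ᶠ n in atTop, p n ∧ ¬ p (n + 1) := by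
  intro h
  obtain ⟨N, hN⟩ := eventually_atTop.1 h
  obtain ⟨n, hn, hpn⟩ := frequently_atTop.1 h1 N
  have key : ∀ m, n ≤ m → p m := by
    intro m hm
    induction m, hm using Nat.le_induction with
    | base => exact hpn
    | succ m hm ih => exact not_not.1 fun hq => hN m (hn.trans hm) ⟨ih, hq⟩
  obtain ⟨m, hm, hpm⟩ := frequently_atTop.1 h2 n
  exact hpm (key m hm)

theorem exists_tendsto_of_eventually_mem_isCompact {α : Type*} (U : Ultrafilter α) {x : α → ℝ}
    {K : Set ℝ} (hK : IsCompact K) (hx : ∀ᶠ a in (U : Filter α), x a ∈ K) :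
    ∃ d ∈ K, Tendsto x U (𝓝 d) :=
  hK.ultrafilter_le_nhds (U.map x) (le_principal_iff.2 hx)

theorem exists_ultrafilter_tendsto_of_frequently {x : ℕ → ℝ} {M : ℝ}
    (hb : ∀ n, x n ∈ Icc (-M) M) {p : ℕ → Prop} (hp : ∃ᶠ n in atTop, p n) :
    ∃ U : Ultrafilter ℕ, (U : Filter ℕ) ≤ atTop ∧ (∀ᶠ n in (U : Filter ℕ), p n) ∧
      ∃ d, Tendsto x U (𝓝 d) := by
  have : (atTop ⊓ 𝓟 {n | p n}).NeBot := frequently_mem_iff_neBot.1 hp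
  refine ⟨Ultrafilter.of (atTop ⊓ 𝓟 {n | p n}), (Ultrafilter.of_le _).trans inf_le_left,
    (Ultrafilter.of_le _).trans inf_le_right (mem_principal_self _), ?_⟩
  obtain ⟨d, -, hd⟩ := exists_tendsto_of_eventually_mem_isCompact
    (Ultrafilter.of (atTop ⊓ 𝓟 {n | p n})) isCompact_Icc (Filter.Eventually.of_forall hb)
  exact ⟨d, hd⟩

/-- A bounded sequence whose limit dynamics is a monotone map with isolated fixed points converges
to a fixed point. If the sequence crossed an interval infinitely often, then comparing with `Φ` at
the crossings of a level `c` downwards and upwards shows `Φ c ≤ c` and `c ≤ Φ c` for every `c` in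
that interval, so the interval would consist of fixed points. -/
theorem exists_fixed_point_tendsto {x : ℕ → ℝ} {Φ : ℝ → ℝ} {M : ℝ} (hΦ : Monotone Φ)
    (hb : ∀ n, x n ∈ Icc (-M) M)
    (hstep : ∀ U : Ultrafilter ℕ, (U : Filter ℕ) ≤ atTop → ∀ d, Tendsto x U (𝓝 d) →
      Tendsto (fun n => x (n + 1)) U (𝓝 (Φ d)))
    (hfix : ∀ a, Φ a = a → ∃ δ > 0, ∀ u ∈ Ioo (a - δ) (a + δ), u ≠ a → Φ u ≠ u) :
    ∃ p, Φ p = p ∧ Tendsto x atTop (𝓝 p) := by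
  have hconv : ∃ p, Tendsto x atTop (𝓝 p) := by
    refine tendsto_of_no_upcrossings dense_univ ?_ ?_ ?_
    · rintro a - b - hab ⟨ha, hb'⟩
      have hc : ∀ c ∈ Icc a b, Φ c = c := by
        intro c hc
        apply le_antisymm
        · obtain ⟨U, hU, hp, d, hd⟩ := exists_ultrafilter_tendsto_of_frequently hb
            (frequently_and_not_succ (p := fun n => c ≤ x n)
              (hb'.mono fun n hn => hc.2.trans hn.le)
              (ha.mono fun n hn => not_le.2 (hn.trans_le hc.1)))
          exact (hΦ (ge_of_tendsto hd (hp.mono fun n hn => hn.1))).trans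
            (le_of_tendsto (hstep U hU d hd) (hp.mono fun n hn => (not_le.1 hn.2).le))
        · obtain ⟨U, hU, hp, d, hd⟩ := exists_ultrafilter_tendsto_of_frequently hb
            (frequently_and_not_succ (p := fun n => x n ≤ c)
              (ha.mono fun n hn => hn.le.trans hc.1)
              (hb'.mono fun n hn => not_le.2 (hc.2.trans_lt hn)))
          exact (ge_of_tendsto (hstep U hU d hd) (hp.mono fun n hn => (not_le.1 hn.2).le)).trans
            (hΦ (le_of_tendsto hd (hp.mono fun n hn => hn.1)))
      obtain ⟨δ, hδ, h⟩ := hfix a (hc a ⟨le_rfl, hab.le⟩)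
      have h1 : 0 < min (δ / 2) (b - a) := lt_min (by linarith) (by linarith)
      have h2 := min_le_left (δ / 2) (b - a)
      have h3 := min_le_right (δ / 2) (b - a)
      exact h (a + min (δ / 2) (b - a)) ⟨by linarith, by linarith⟩ (by linarith)
        (hc _ ⟨by linarith, by linarith⟩)
    · exact isBoundedUnder_of ⟨M, fun n => (hb n).2⟩
    · exact isBoundedUnder_of ⟨-M, fun n => (hb n).1⟩
  obtain ⟨p, hp⟩ := hconv
  refine ⟨p, ?_, hp⟩
  have hU : ((hyperfilter ℕ : Ultrafilter ℕ) : Filter ℕ) ≤ atTop := Nat.hyperfilter_le_atTop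
  exact tendsto_nhds_unique (hstep _ hU p (hp.mono_left hU))
    (((tendsto_add_atTop_iff_nat 1).2 hp).mono_left hU)

/-! ### Solutions of scalar equations on the half-line -/

/-- `x` solves `x' = g(t, x)` on `[0, ∞)`, for a right-hand side given on real times. The value of
`g` at negative times is irrelevant. -/
def SolvesOnNonneg (g : ℝ → ℝ → ℝ) (x : ℝ → ℝ) : Prop :=
  ∀ t : ℝ, 0 ≤ t → HasDerivWithinAt x (g t (x t)) (Ici 0) t

theorem SolvesOnNonneg.continuousOn {g : ℝ → ℝ → ℝ} {x : ℝ → ℝ} (hx : SolvesOnNonneg g x) :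
    ContinuousOn x (Ici 0) :=
  fun t ht => (hx t ht).continuousWithinAt

theorem SolvesOnNonneg.translate {g : ℝ → ℝ → ℝ} {x : ℝ → ℝ} (hx : SolvesOnNonneg g x) {s : ℝ}
    (hs : 0 ≤ s) : SolvesOnNonneg (fun t => g (t + s)) (fun t => x (t + s)) := by
  intro t ht
  have h := (hx (t + s) (by linarith)).scomp t
    (((hasDerivAt_id t).add_const s).hasDerivWithinAt (s := Ici 0))
    (fun u (hu : 0 ≤ u) => show (0 : ℝ) ≤ u + s by linarith)
  simpa [Function.comp_def] using h

/-- Forward uniqueness for all translated equations makes the flow order preserving: two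
solutions that exchange their order meet at some time, and agree from then on. -/
theorem SolvesOnNonneg.le_of_le {g : ℝ → ℝ → ℝ}
    (huniq : ∀ s, 0 ≤ s → ∀ y z, SolvesOnNonneg (fun t => g (t + s)) y →
      SolvesOnNonneg (fun t => g (t + s)) z → y 0 = z 0 → EqOn y z (Ici 0))
    {y z : ℝ → ℝ} (hy : SolvesOnNonneg g y) (hz : SolvesOnNonneg g z) (h0 : y 0 ≤ z 0)
    {t : ℝ} (ht : 0 ≤ t) : y t ≤ z t := by
  by_contra! hlt
  have hc : ContinuousOn (fun s => y s - z s) (Icc 0 t) :=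
    (hy.continuousOn.sub hz.continuousOn).mono Icc_subset_Ici_self
  obtain ⟨s, hs, hs0⟩ := intermediate_value_Icc ht hc
    (show (0 : ℝ) ∈ Icc (y 0 - z 0) (y t - z t) from ⟨by linarith, by linarith⟩)
  have h := huniq s hs.1 _ _ (hy.translate hs.1) (hz.translate hs.1)
    (by simp only [zero_add]; simp only at hs0; linarith)
    (show t - s ∈ Ici (0 : ℝ) from sub_nonneg.2 hs.2)
  simp only [sub_add_cancel] at h
  exact hlt.ne' h

/-! ### Bounded solutions of perturbed periodic equations -/

theorem apply_add_nat_mul {α : Type*} {τ : ℝ} (hτ : 0 < τ) {ψ : ℝ → α}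
    (h : ∀ t, 0 ≤ t → ψ (t + τ) = ψ t) (n : ℕ) {t : ℝ} (ht : 0 ≤ t) : ψ (t + n * τ) = ψ t := by
  induction n with
  | zero => simp
  | succ n ih =>
    rw [← ih, ← h (t + n * τ) (by positivity)]
    congr 1
    push_cast
    ring

theorem sub_floor_mul_mem_Ico {τ : ℝ} (hτ : 0 < τ) {t : ℝ} (ht : 0 ≤ t) :
    t - ⌊t / τ⌋₊ * τ ∈ Ico 0 τ := by
  have h1 := Nat.floor_le (div_nonneg ht hτ.le)
  have h2 := Nat.lt_floor_add_one (t / τ)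
  rw [le_div_iff₀ hτ] at h1
  rw [div_lt_iff₀ hτ] at h2
  constructor <;> linarith

/-- A bounded solution of a perturbed periodic equation is Lipschitz from some time on. -/
theorem exists_lipschitzOnWith_Ici {τ : ℝ} (hτ : 0 < τ) {P : ℝ → ℝ → ℝ}
    (hP : Continuous fun z : ℝ × ℝ => P z.1 z.2) (hper : ∀ t, 0 ≤ t → P (t + τ) = P t)
    {φ r : ℝ → ℝ} (hφ : SolvesOnNonneg (fun t x => P t x + r t) φ) (hr : Tendsto r atTop (𝓝 0))
    {M : ℝ} (hM : ∀ t, 0 ≤ t → |φ t| ≤ M) :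
    ∃ A C, LipschitzOnWith C φ (Ici A) := by
  obtain ⟨B, hB⟩ := ((isCompact_Icc (a := (0 : ℝ)) (b := τ)).prod
    (isCompact_Icc (a := -M) (b := M))).exists_bound_of_continuousOn hP.continuousOn
  have hB' : ∀ t, 0 ≤ t → |P t (φ t)| ≤ B := by
    intro t ht
    have hs := sub_floor_mul_mem_Ico hτ ht
    have h := apply_add_nat_mul hτ hper ⌊t / τ⌋₊ hs.1
    rw [sub_add_cancel] at h
    rw [h]
    exact hB (_, φ t) ⟨Ico_subset_Icc_self hs, abs_le.1 (hM t ht)⟩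
  obtain ⟨A, hA⟩ := eventually_atTop.1 (hr.eventually (Metric.ball_mem_nhds 0 one_pos))
  have hBn : 0 ≤ B := (abs_nonneg _).trans (hB' 0 le_rfl)
  refine ⟨max A 0, (B + 1).toNNReal, ?_⟩
  refine (convex_Ici _).lipschitzOnWith_of_nnnorm_hasDerivWithin_le
    (f' := fun t => P t (φ t) + r t) ?_ ?_
  · exact fun t ht => (hφ t ((le_max_right _ _).trans ht)).mono
      (Ici_subset_Ici.2 (le_max_right _ _))
  · intro t ht
    have h1 := hB' t ((le_max_right _ _).trans ht)
    have h2 := hA t ((le_max_left _ _).trans ht)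
    rw [dist_zero_right, Real.norm_eq_abs] at h2
    rw [← NNReal.coe_le_coe, coe_nnnorm, Real.norm_eq_abs,
      Real.coe_toNNReal _ (by positivity)]
    exact (abs_add_le _ _).trans (add_le_add h1 h2.le)

/-- Limits of the translates of `φ` by multiples of the period solve the unperturbed periodic
equation. Pointwise convergence along an arbitrary filter is enough, because the translates are
eventually Lipschitz with a common constant: near a time `t`, the slopes of all late translates
are close to `P(t, y(t))`, and the mean value inequality survives the limit. -/
theorem SolvesOnNonneg.of_tendsto_translates {τ : ℝ} (hτ : 0 < τ) {P : ℝ → ℝ → ℝ}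
    (hP : Continuous fun z : ℝ × ℝ => P z.1 z.2) (hper : ∀ t, 0 ≤ t → P (t + τ) = P t)
    {φ r : ℝ → ℝ} (hφ : SolvesOnNonneg (fun t x => P t x + r t) φ) (hr : Tendsto r atTop (𝓝 0))
    {A : ℝ} {C : NNReal} (hL : LipschitzOnWith C φ (Ici A))
    {l : Filter ℕ} [l.NeBot] (hl : l ≤ atTop) {y : ℝ → ℝ}
    (hy : ∀ t, 0 ≤ t → Tendsto (fun n : ℕ => φ (t + n * τ)) l (𝓝 (y t))) :
    SolvesOnNonneg P y := by
  intro t ht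
  rw [hasDerivWithinAt_iff_isLittleO, Asymptotics.isLittleO_iff]
  intro ε hε
  obtain ⟨δ, hδ, hPδ⟩ := Metric.continuous_iff.1 hP (t, y t) (ε / 2) (by linarith)
  -- On the interval of radius `η`, a translate within `δ / 2` of `y t` at time `t` stays within `δ`.
  obtain ⟨η, hη, hηδ, hηC⟩ : ∃ η > 0, η ≤ δ ∧ C * η ≤ δ / 2 := by
    refine ⟨min δ (δ / 2 / (C + 1)), by positivity, min_le_left _ _, ?_⟩
    have h1 : (C : ℝ) * min δ (δ / 2 / (C + 1)) ≤ (C + 1) * (δ / 2 / (C + 1)) :=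
      mul_le_mul (by linarith) (min_le_right _ _) (by positivity) (by positivity)
    rwa [mul_div_cancel₀ _ (by positivity)] at h1
  obtain ⟨B, hB⟩ := eventually_atTop.1
    (hr.eventually (Metric.ball_mem_nhds 0 (show 0 < ε / 2 by linarith)))
  have hlarge : ∀ᶠ n : ℕ in l, max A B ≤ n * τ :=
    hl ((tendsto_natCast_atTop_atTop.atTop_mul_const hτ).eventually_ge_atTop _)
  have hclose : ∀ᶠ n : ℕ in l, dist (φ (t + n * τ)) (y t) < δ / 2 :=
    (hy t ht).eventually (Metric.ball_mem_nhds _ (by linarith))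
  filter_upwards [self_mem_nhdsWithin,
    mem_nhdsWithin_of_mem_nhds (Metric.ball_mem_nhds t hη)] with s hs0 hs
  rw [mem_Ici] at hs0
  refine le_of_tendsto ((((hy s hs0).sub (hy t ht)).sub_const _).norm) ?_
  filter_upwards [hlarge, hclose] with n hn hc
  have hA := (le_max_left A B).trans hn
  have hB' := (le_max_right A B).trans hn
  have hconv : Convex ℝ (Ici 0 ∩ Metric.ball t η) := (convex_Ici 0).inter (convex_ball t η)
  have hmv := hconv.norm_image_sub_le_of_norm_hasDerivWithin_le
    (f := fun u => φ (u + n * τ) - u * P t (y t)) (C := ε)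
    (f' := fun u => P (u + n * τ) (φ (u + n * τ)) + r (u + n * τ) - P t (y t))
    (x := t) (y := s) ?_ ?_ ⟨ht, Metric.mem_ball_self hη⟩ ⟨hs0, hs⟩
  · refine le_of_eq_of_le ?_ hmv
    congr 1
    simp only [smul_eq_mul]
    ring
  · intro u hu
    have h := ((hφ.translate (s := n * τ) (by positivity)) u hu.1).sub
      (((hasDerivAt_id u).mul_const (P t (y t))).hasDerivWithinAt)
    rw [one_mul] at h
    exact h.mono inter_subset_left
  · intro u hu
    have hu0 : 0 ≤ u := hu.1
    have hut : dist u t < η := hu.2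
    rw [apply_add_nat_mul hτ hper n hu0]
    have h1 : dist (φ (u + n * τ)) (φ (t + n * τ)) ≤ C * dist u t := by
      simpa using hL.dist_le_mul (u + n * τ) (show A ≤ _ by linarith) (t + n * τ)
        (show A ≤ _ by linarith)
    have h2 : dist (φ (u + n * τ)) (y t) < δ := by
      have h3 := dist_triangle (φ (u + n * τ)) (φ (t + n * τ)) (y t)
      have h4 : C * dist u t ≤ C * η := mul_le_mul_of_nonneg_left hut.le C.2
      linarith
    have h5 := hPδ (u, φ (u + n * τ)) (by
      rw [Prod.dist_eq]
      exact max_lt (hut.trans_le hηδ) h2)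
    have h6 := hB (u + n * τ) (by linarith)
    rw [dist_zero_right, Real.norm_eq_abs] at h6
    rw [Real.dist_eq] at h5
    simp only at h5
    rw [Real.norm_eq_abs, show P u (φ (u + n * τ)) + r (u + n * τ) - P t (y t)
      = (P u (φ (u + n * τ)) - P t (y t)) + r (u + n * τ) by ring]
    exact (abs_add_le _ _).trans (by linarith)

/-- Pointwise convergence of the translates by multiples of the period, for an eventually
Lipschitz function, is uniform over one period, hence gives asymptotic periodicity. -/
theorem isAsymptoticallyPeriodic_of_tendsto_translates {τ : ℝ} (hτ : 0 < τ) {φ ψ : ℝ → ℝ}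
    {A : ℝ} {C : NNReal} (hL : LipschitzOnWith C φ (Ici A)) (hψ : ContinuousOn ψ (Ici 0))
    (hper : ∀ t, 0 ≤ t → ψ (t + τ) = ψ t)
    (hlim : ∀ t, 0 ≤ t → Tendsto (fun n : ℕ => φ (t + n * τ)) atTop (𝓝 (ψ t))) :
    IsAsymptoticallyPeriodic τ φ := by
  have : Fact (0 < τ) := ⟨hτ⟩
  have hcont : Continuous (AddCircle.liftIco τ 0 ψ) :=
    AddCircle.liftIco_continuous (by simpa using (hper 0 le_rfl).symm)
      (hψ.mono Icc_subset_Ici_self)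
  refine ⟨fun t => AddCircle.liftIco τ 0 ψ (t : AddCircle τ),
    hcont.comp (AddCircle.continuous_mk' τ), fun t => by simp, ?_⟩
  rw [tendsto_iff_ultrafilter]
  intro V hV
  have hmem : ∀ᶠ t in (V : Filter ℝ), t - ⌊t / τ⌋₊ * τ ∈ Icc 0 τ := by
    filter_upwards [hV (eventually_ge_atTop 0)] with t ht
    exact Ico_subset_Icc_self (sub_floor_mul_mem_Ico hτ ht)
  -- The phase of `t` within a period converges along the ultrafilter.
  obtain ⟨s, hs, hVs⟩ := exists_tendsto_of_eventually_mem_isCompact V isCompact_Icc hmem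
  have hfloor : Tendsto (fun t : ℝ => ⌊t / τ⌋₊) V atTop :=
    (tendsto_nat_floor_atTop.comp (tendsto_id.atTop_div_const hτ)).mono_left hV
  have h1 : Tendsto (fun t : ℝ => φ (s + ⌊t / τ⌋₊ * τ)) V (𝓝 (ψ s)) := (hlim s hs.1).comp hfloor
  have h2 : Tendsto (fun t : ℝ => ψ (t - ⌊t / τ⌋₊ * τ)) V (𝓝 (ψ s)) :=
    (hψ s hs.1).tendsto.comp
      (tendsto_nhdsWithin_iff.2 ⟨hVs, hmem.mono fun t ht => ht.1⟩)
  have h3 : Tendsto (fun t : ℝ => φ t - φ (s + ⌊t / τ⌋₊ * τ)) V (𝓝 0) := by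
    have hbound : Tendsto (fun t : ℝ => C * dist (t - ⌊t / τ⌋₊ * τ) s) V (𝓝 0) := by
      simpa using (tendsto_iff_dist_tendsto_zero.1 hVs).const_mul (C : ℝ)
    refine squeeze_zero_norm' ?_ hbound
    have hA : ∀ᶠ t in (V : Filter ℝ), A ≤ ⌊t / τ⌋₊ * τ :=
      ((tendsto_natCast_atTop_atTop.comp hfloor).atTop_mul_const hτ).eventually_ge_atTop A
    filter_upwards [hA, hmem] with t ht htm
    have h := hL.dist_le_mul t (show A ≤ t by linarith [htm.1]) (s + ⌊t / τ⌋₊ * τ)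
      (show A ≤ _ by linarith [hs.1])
    rw [← dist_eq_norm]
    refine h.trans_eq ?_
    rw [Real.dist_eq, Real.dist_eq]
    congr 2
    ring
  have h4 : Tendsto (fun t : ℝ => |(φ t - φ (s + ⌊t / τ⌋₊ * τ)) +
      (φ (s + ⌊t / τ⌋₊ * τ) - ψ (t - ⌊t / τ⌋₊ * τ))|) V (𝓝 0) := by
    simpa using (h3.add (h1.sub h2)).abs
  refine h4.congr' ?_
  filter_upwards [hV (eventually_ge_atTop 0)] with t ht
  have hp : AddCircle.liftIco τ 0 ψ (t : AddCircle τ) = ψ (t - ⌊t / τ⌋₊ * τ) := by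
    have ht' := sub_floor_mul_mem_Ico hτ ht
    rw [← AddCircle.liftIco_coe_apply (p := τ) (a := 0) (f := ψ) (by simpa using ht')]
    congr 1
    rw [AddCircle.coe_sub, ← nsmul_eq_mul, AddCircle.coe_nsmul, AddCircle.coe_period, nsmul_zero,
      sub_zero]
  rw [hp]
  congr 1
  ring

/-- The theorem for right-hand sides on real times: along a bounded solution the vanishing part of
the equation is just a vanishing forcing term `r`. -/
theorem isAsymptoticallyPeriodic_of_solvesOnNonneg {τ : ℝ} (hτ : 0 < τ) {P : ℝ → ℝ → ℝ}
    (hP : Continuous fun z : ℝ × ℝ => P z.1 z.2) (hper : ∀ t, 0 ≤ t → P (t + τ) = P t)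
    (hex : ∀ u, ∃ x, SolvesOnNonneg P x ∧ x 0 = u)
    (huniq : ∀ s, 0 ≤ s → ∀ y z, SolvesOnNonneg (fun t => P (t + s)) y →
      SolvesOnNonneg (fun t => P (t + s)) z → y 0 = z 0 → EqOn y z (Ici 0))
    (hiso : ∀ x, SolvesOnNonneg P x → (∀ t, 0 ≤ t → x (t + τ) = x t) →
      ∃ δ > 0, ∀ u ∈ Ioo (x 0 - δ) (x 0 + δ), u ≠ x 0 →
        ¬ ∃ y, (SolvesOnNonneg P y ∧ ∀ t, 0 ≤ t → y (t + τ) = y t) ∧ y 0 = u)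
    {φ r : ℝ → ℝ} (hφ : SolvesOnNonneg (fun t x => P t x + r t) φ) (hr : Tendsto r atTop (𝓝 0))
    {M : ℝ} (hM : ∀ t, 0 ≤ t → |φ t| ≤ M) : IsAsymptoticallyPeriodic τ φ := by
  obtain ⟨A, C, hL⟩ := exists_lipschitzOnWith_Ici hτ hP hper hφ hr hM
  choose S hS hS0 using hex
  have huniq0 : ∀ y, SolvesOnNonneg P y → EqOn y (S (y 0)) (Ici 0) := fun y hy =>
    huniq 0 le_rfl _ _ (by simpa using hy) (by simpa using hS (y 0)) (hS0 _).symm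
  have hmono : Monotone fun u => S u τ := fun u v huv =>
    SolvesOnNonneg.le_of_le huniq (hS u) (hS v) (by rwa [hS0, hS0]) hτ.le
  -- Along an ultrafilter the translates of `φ` converge to the solution from the limit point.
  have hlim : ∀ U : Ultrafilter ℕ, (U : Filter ℕ) ≤ atTop → ∀ d,
      Tendsto (fun n : ℕ => φ (n * τ)) U (𝓝 d) → ∀ t, 0 ≤ t →
        Tendsto (fun n : ℕ => φ (t + n * τ)) U (𝓝 (S d t)) := by
    intro U hU d hd
    have hpt : ∀ t : ℝ, ∃ v, 0 ≤ t → Tendsto (fun n : ℕ => φ (t + n * τ)) U (𝓝 v) := by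
      intro t
      by_cases ht : 0 ≤ t
      · obtain ⟨v, -, hv⟩ := exists_tendsto_of_eventually_mem_isCompact U
          (x := fun n : ℕ => φ (t + n * τ)) (isCompact_Icc (a := -M) (b := M))
          (Filter.Eventually.of_forall fun n : ℕ => abs_le.1 (hM (t + n * τ) (by positivity)))
        exact ⟨v, fun _ => hv⟩
      · exact ⟨0, fun h => absurd h ht⟩
    choose y hy using hpt
    have hysol := SolvesOnNonneg.of_tendsto_translates hτ hP hper hφ hr hL hU hy
    have hy0 : y 0 = d := tendsto_nhds_unique (hy 0 le_rfl) (by simpa using hd)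
    intro t ht
    have h := huniq0 y hysol ht
    rw [hy0] at h
    rw [← h]
    exact hy t ht
  have hperiodic : ∀ u, S u τ = u → ∀ t, 0 ≤ t → S u (t + τ) = S u t := by
    intro u hu t ht
    have htr : SolvesOnNonneg P fun t => S u (t + τ) := by
      intro t ht
      have h := (hS u).translate hτ.le t ht
      beta_reduce at h
      rwa [hper t ht] at h
    have h := huniq0 _ htr ht
    simpa [hu] using h
  obtain ⟨p, hp, hxp⟩ := exists_fixed_point_tendsto (x := fun n : ℕ => φ (n * τ)) (M := M) hmono
    (fun n => abs_le.1 (hM _ (by positivity)))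
    (fun U hU d hd => by
      refine (hlim U hU d hd τ hτ.le).congr fun n => ?_
      congr 1
      push_cast
      ring)
    (fun a ha => by
      obtain ⟨δ, hδ, h⟩ := hiso (S a) (hS a) (hperiodic a ha)
      rw [hS0] at h
      exact ⟨δ, hδ, fun u hu hua hfix => h u hu hua ⟨S u, ⟨hS u, hperiodic u hfix⟩, hS0 u⟩⟩)
  refine isAsymptoticallyPeriodic_of_tendsto_translates hτ hL (hS p).continuousOn
    (hperiodic p hp) fun t ht => ?_
  rw [tendsto_iff_ultrafilter]
  exact fun U hU => hlim U hU p (hxp.mono_left hU) t ht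

/-! ### The hull and passage to real times -/

/-- The translates of `f` by `h + nτ` converge to the translate of the periodic part by `h`. -/
theorem IsAsymptoticallyPeriodicDecomposition.timeTranslate_mem_hull {T : AddSubmonoid ℝ} {τ : T}
    (hτ : 0 < (τ : ℝ)) {f P R : C(T × ℝ, ℝ)} (hf : IsAsymptoticallyPeriodicDecomposition τ f P R)
    (h : T) : timeTranslate P h ∈ hull f := by
  have hPn : ∀ (n : ℕ) (t : T) (x : ℝ), P (t + n • τ, x) = P (t, x) := by
    intro n t x
    induction n with
    | zero => simp
    | succ n ih => rw [succ_nsmul, ← add_assoc, hf.periodic, ih]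
  refine mem_closure_of_tendsto (f := fun n : ℕ => timeTranslate f (h + n • τ)) (b := atTop) ?_
    (Filter.Eventually.of_forall fun n => mem_range_self _)
  rw [ContinuousMap.tendsto_iff_forall_isCompact_tendstoUniformlyOn]
  intro K hK
  rw [Metric.tendstoUniformlyOn_iff]
  intro ε hε
  obtain ⟨a, ha⟩ := eventually_atTop.1 (Metric.tendstoUniformlyOn_iff.1
    (hf.tendsto_zero _ (hK.image continuous_snd)) ε hε)
  obtain ⟨b, hb⟩ := (hK.image (continuous_subtype_val.comp continuous_fst)).bddBelow
  filter_upwards [(tendsto_natCast_atTop_atTop.atTop_mul_const hτ).eventually_ge_atTop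
    ((a : ℝ) - h - b)] with n hn z hz
  have hbz : b ≤ (z.1 : ℝ) := hb ⟨z, hz, rfl⟩
  have haz : a ≤ z.1 + (h + n • τ) := by
    rw [← Subtype.coe_le_coe]
    push_cast
    rw [nsmul_eq_mul]
    linarith
  have hR := ha _ haz z.2 ⟨z, hz, rfl⟩
  rw [dist_zero_left, Real.norm_eq_abs] at hR
  have e : f (z.1 + (h + n • τ), z.2) = P (z.1 + h, z.2) + R (z.1 + (h + n • τ), z.2) := by
    rw [hf.eq_add, ← add_assoc, hPn]
  change dist (P (z.1 + h, z.2)) (f (z.1 + (h + n • τ), z.2)) < ε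
  rwa [e, dist_self_add_right, Real.norm_eq_abs]

/-- A right-hand side on `T × ℝ` as a function of real times, frozen for `t < 0` at `t = 0`. -/
def onReal {T : AddSubmonoid ℝ} (hT : ∀ t : ℝ, 0 ≤ t → t ∈ T) (g : C(T × ℝ, ℝ)) (t x : ℝ) : ℝ :=
  g (⟨max t 0, hT _ (le_max_right _ _)⟩, x)

theorem continuous_onReal {T : AddSubmonoid ℝ} (hT : ∀ t : ℝ, 0 ≤ t → t ∈ T) (g : C(T × ℝ, ℝ)) :
    Continuous fun z : ℝ × ℝ => onReal hT g z.1 z.2 := by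
  unfold onReal
  fun_prop

theorem onReal_coe {T : AddSubmonoid ℝ} (hT : ∀ t : ℝ, 0 ≤ t → t ∈ T) (g : C(T × ℝ, ℝ)) (t : T)
    (ht : 0 ≤ (t : ℝ)) (x : ℝ) : onReal hT g t x = g (t, x) := by
  simp [onReal, max_eq_left ht]

theorem solvesOnNonneg_onReal_iff {T : AddSubmonoid ℝ} (hT : ∀ t : ℝ, 0 ≤ t → t ∈ T)
    (g : C(T × ℝ, ℝ)) (x : ℝ → ℝ) : SolvesOnNonneg (onReal hT g) x ↔ IsSolution g x := by
  constructor
  · intro h t ht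
    rw [← onReal_coe hT g t ht]
    exact h t ht
  · intro h t ht
    have := h ⟨t, hT t ht⟩ ht
    rwa [← onReal_coe hT g ⟨t, hT t ht⟩ ht] at this

end AsympPeriodic

theorem mainTheorem6 (T : AddSubmonoid ℝ) (hT : T = AddSubmonoid.nonneg ℝ ∨ T = ⊤)
    (τ : T) (hτ : 0 < (τ : ℝ)) (f P R : C(T × ℝ, ℝ))
    (hreg : AsympPeriodic.IsRegularRHS f)
    (hf : AsympPeriodic.IsAsymptoticallyPeriodicDecomposition τ f P R)
    (hiso : ∀ x : ℝ → ℝ, AsympPeriodic.IsPeriodicSolution τ P x →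
      AsympPeriodic.IsIsolatedPeriodicSolution τ P x)
    (φ : ℝ → ℝ) (hφ : AsympPeriodic.IsSolution f φ)
    (hbdd : ∃ M : ℝ, ∀ t : ℝ, 0 ≤ t → |φ t| ≤ M) :
    AsympPeriodic.IsAsymptoticallyPeriodic (τ : ℝ) φ := by
  open AsympPeriodic in
  have hmem : ∀ t : ℝ, 0 ≤ t → t ∈ T := by
    rcases hT with rfl | rfl
    · exact fun t ht => ht
    · exact fun t _ => AddSubmonoid.mem_top t
  obtain ⟨M, hM⟩ := hbdd
  have hiff := solvesOnNonneg_onReal_iff hmem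
  -- Uniqueness for the translates of `P`, read off from regularity of `f`.
  have huniq : ∀ s, 0 ≤ s → ∀ y z, SolvesOnNonneg (fun t => onReal hmem P (t + s)) y →
      SolvesOnNonneg (fun t => onReal hmem P (t + s)) z → y 0 = z 0 → EqOn y z (Ici 0) := by
    intro s hs y z hy hz h0
    have key : ∀ w, SolvesOnNonneg (fun t => onReal hmem P (t + s)) w →
        IsSolution (timeTranslate P ⟨s, hmem s hs⟩) w := by
      intro w hw t ht
      have h := hw t ht
      beta_reduce at h
      rwa [show (t : ℝ) + s = ((t + ⟨s, hmem s hs⟩ : T) : ℝ) from rfl,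
        onReal_coe hmem P _ (add_nonneg ht hs)] at h
    obtain ⟨x, -, hx⟩ := hreg (z 0) _ (hf.timeTranslate_mem_hull hτ ⟨s, hmem s hs⟩)
    exact (hx y (key y hy) h0).trans (hx z (key z hz) rfl).symm
  have hex : ∀ u, ∃ x, SolvesOnNonneg (onReal hmem P) x ∧ x 0 = u := by
    intro u
    obtain ⟨x, ⟨hx, hx0⟩, -⟩ := hreg u _ (hf.timeTranslate_mem_hull hτ 0)
    refine ⟨x, (hiff P x).2 fun t ht => ?_, hx0⟩
    have h := hx t ht
    rwa [show timeTranslate P 0 (t, x t) = P (t, x t) by simp [timeTranslate]] at h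
  refine isAsymptoticallyPeriodic_of_solvesOnNonneg hτ (continuous_onReal hmem P) ?_ hex huniq ?_
    (r := fun t => onReal hmem R t (φ t)) ?_ ?_ hM
  · intro t ht
    funext x
    have h1 := onReal_coe hmem P (⟨t, hmem t ht⟩ + τ) (add_nonneg ht hτ.le) x
    have h2 := onReal_coe hmem P ⟨t, hmem t ht⟩ ht x
    exact h1.trans ((hf.periodic _ x).trans h2.symm)
  · intro x hx hxp
    obtain ⟨-, δ, hδ, h⟩ := hiso x ⟨(hiff P x).1 hx, hxp⟩
    refine ⟨δ, hδ, fun u hu hux => ?_⟩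
    rintro ⟨y, ⟨hy, hyp⟩, hyu⟩
    exact h u hu hux ⟨y, ⟨(hiff P y).1 hy, hyp⟩, hyu⟩
  · intro t ht
    have h := (hiff f φ).2 hφ t ht
    rwa [show onReal hmem f t (φ t) = onReal hmem P t (φ t) + onReal hmem R t (φ t) from
      hf.eq_add _ _] at h
  · rw [Metric.tendsto_nhds]
    intro ε hε
    obtain ⟨a, ha⟩ := eventually_atTop.1 (Metric.tendstoUniformlyOn_iff.1
      (hf.tendsto_zero _ (isCompact_Icc (a := -M) (b := M))) ε hε)
    filter_upwards [eventually_ge_atTop (a : ℝ), eventually_ge_atTop 0] with t hta ht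
    have h := ha ⟨t, hmem t ht⟩ hta (φ t) (abs_le.1 (hM t ht))
    rwa [← onReal_coe hmem R _ ht, dist_comm] at h
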